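/- Let $R$ be a commutative unital ring and let $\mathcal P$ be a (symmetric, algebraic) operad over $R$: a sequence of $R$-modules $\mathcal P(n)$, $n\in\mathbb N$, each with an $R$-linear right action of the symmetric group $\Sigma(n)$, a unit $1_{\mathcal P}\in\mathcal P(1)$ and $R$-linear partial compositions $\circ_i:\mathcal P(m)\otimes\mathcal P(n)\to\mathcal P(m+n-1)$, $1\le i\le m$, that are unital, (sequentially and parallelly) associative and equivariant. Write $\mu(\nu_1,\dots,\nu_k)=(\cdots((\mu\circ_k\nu_k)\circ_{k-1}\nu_{k-1})\cdots)\circ_1\nu_1$. A $\mathcal P$-algebra is an $R$-module $A$ with an $R$-linear map $\theta:\bigoplus_n(\mathcal P(n)\otimes A^{\otimes n})_{\Sigma(n)}\to A$ such that, with $\mu(a_1,\dots,a_n):=\theta(\mu;a_1,\dots,a_n)$, one has $1_{\mathcal P}(a)=a$ and $\mu(\nu_1(a_{1,1},\dots),\dots,\nu_k(a_{k,1},\dots))=\mu(\nu_1,\dots,\nu_k)(a_{1,1},\dots,a_{k,n_k})$. A morphism of $\mathcal P$-algebras is an $R$-linear map $f$ with $f(\mu(a_1,\dots,a_n))=\mu(f(a_1),\dots,f(a_n))$;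 $\mathsf{ALG}_{\mathcal P}$ is the resulting category. For a $\mathcal P$-algebra $A$ and $n\in\mathbb N$ let $A\ltimes A^n$ be the $R$-module $A\times A^n$ with the $\mathcal P$-algebra structure $$\mu\big((a_1,\vec b_1),\dots,(a_m,\vec b_m)\big)=\Big(\mu(a_1,\dots,a_m),\ \sum_{i=1}^m\mu(a_1,\dots,b_{i,1},\dots,a_m),\ \dots,\ \sum_{i=1}^m\mu(a_1,\dots,b_{i,n},\dots,a_m)\Big),$$ where $b_{i,j}$ stands in the $i$-th place; write $A\ltimes A$ for $n=1$. Define: (i) the functor $\mathsf T(A)=A\ltimes A$, $\mathsf T(f)(a,b)=(f(a),f(b))$; (ii) $p_A:A\ltimes A\to A$, $p_A(a,b)=a$, together with $\mathsf T_n(A)=A\ltimes A^n$ and $q_j:A\ltimes A^n\to A\ltimes A$, $q_j(a,b_1,\dots,b_n)=(a,b_j)$; (iii) $s_A:A\ltimes A^2\to A\ltimes A$, $s_A(a,b_1,b_2)=(a,b_1+b_2)$; (iv) $z_A:A\to A\ltimes A$, $z_A(a)=(a,0)$; (v) $l_A:A\ltimes A\to(A\ltimes A)\ltimes(A\ltimes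 A)$, $l_A(a,b)=(a,0,0,b)$; (vi) $c_A:(A\ltimes A)\ltimes(A\ltimes A)\to(A\ltimes A)\ltimes(A\ltimes A)$, $c_A(a,b,c,d)=(a,c,b,d)$; (vii) $n_A:A\ltimes A\to A\ltimes A$, $n_A(a,b)=(a,-b)$. Theorem. $\mathbb T=(\mathsf T,p,s,z,l,c,n)$ is a Rosický tangent structure on $\mathsf{ALG}_{\mathcal P}$, where the $n$-fold pullback of $p_A$ is $\mathsf T_n(A)=A\ltimes A^n$ with projections $q_j$, and $(\mathsf{ALG}_{\mathcal P},\mathbb T)$ is a Cartesian Rosický tangent category. That is: all the maps above are morphisms of $\mathcal P$-algebras, natural in $A$, and - for all $m,n\ge 0$, $\mathsf T^m(\mathsf T_n(A))$ is the $n$-fold pullback of $\mathsf T^m(p_A)$ with projections $\mathsf T^m(q_j)$ (for $n=0$: $\mathsf T_0(A)\cong A$); - $p_A$ with sum $s_A$ and zero $z_A$ is a commutative monoid over $A$, and $n_A$ is an inverse: $p_A n_A=p_A$, $s_A\langle 1,n_A\rangle=z_Ap_A$; - $(l_A,z_A)$ is a morphism of additive bundles from $p_A$ to $\mathsf T(p_A)$,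 and $(c_A,1)$ is one from $\mathsf T(p_A)$ to $p_{\mathsf T(A)}$; - $c_Ac_A=1$, $c_Al_A=l_A$, $\mathsf T(l_A)l_A=l_{\mathsf T(A)}l_A$, $\mathsf T(c_A)c_{\mathsf T(A)}\mathsf T(c_A)=c_{\mathsf T(A)}\mathsf T(c_A)c_{\mathsf T(A)}$, $c_{\mathsf T(A)}\mathsf T(c_A)l_{\mathsf T(A)}=\mathsf T(l_A)c_A$; - the map $\mathsf T(s_A)\langle l_Aq_1,z_{\mathsf T(A)}q_2\rangle:\mathsf T_2(A)\to\mathsf T^2(A)$ is the equalizer of $\mathsf T(p_A)$ and $z_Ap_A\mathsf T(p_A)$ (equivalently, it exhibits $\mathsf T_2(A)$ as the pullback of $z_A$ along $\mathsf T(p_A)$), and this pullback is preserved by all $\mathsf T^m$; - $\mathsf{ALG}_{\mathcal P}$ has finite products, and the canonical maps $\mathsf T(A_1\times\dots\times A_n)\to\mathsf T(A_1)\times\dots\times\mathsf T(A_n)$ and $\mathsf T(\ast)\to\ast$ are isomorphisms. -/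

import Mathlib

open CategoryTheory CategoryTheory.Limits
open scoped TensorProduct

universe u v w u₁ v₁

/-! ### Cartesian Rosický tangent categories -/

/-- The iterates `Tᵐ` of an endofunctor. -/
def iterFunctor {C : Type u₁} [Category.{v₁} C] (T : C ⥤ C) : ℕ → (C ⥤ C)
  | 0 => 𝟭 C
  | m + 1 => iterFunctor T m ⋙ T

/-- The data `(T, p, s, z, l, c, n)` of a Rosický tangent structure, together with the functors `Tₙ`
and projections `qⱼ : Tₙ ⟶ T` that are to be the `n`-fold pullbacks of `p` (`base n : Tₙ ⟶ 𝟭` is the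
common value of `p ∘ qⱼ`; it has to be given for `n = 0`). -/
structure RosickyTangentData (C : Type u₁) [Category.{v₁} C] where
  /-- The tangent bundle functor. -/
  T : C ⥤ C
  /-- The projection. -/
  p : T ⟶ 𝟭 C
  /-- The `n`-fold pullback of the projection. -/
  Tn : ℕ → (C ⥤ C)
  /-- The projection of the `n`-fold pullback to the base. -/
  base : ∀ n, Tn n ⟶ 𝟭 C
  /-- The projections of the `n`-fold pullback. -/
  q : ∀ n, Fin n → (Tn n ⟶ T)
  q_p : ∀ n (j : Fin n), q n j ≫ p = base n
  /-- The sum. -/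
  s : Tn 2 ⟶ T
  /-- The zero map. -/
  z : 𝟭 C ⟶ T
  /-- The vertical lift. -/
  l : T ⟶ T ⋙ T
  /-- The canonical flip. -/
  c : T ⋙ T ⟶ T ⋙ T
  /-- The negative map. -/
  neg : T ⟶ T

namespace RosickyTangentData

variable {C : Type u₁} [Category.{v₁} C] (D : RosickyTangentData C)

theorem q_p_app (n : ℕ) (j : Fin n) (A : C) :
    (D.q n j).app A ≫ D.p.app A = (D.base n).app A := by
  rw [← NatTrans.comp_app, D.q_p]

/-- The cone that exhibits `Tᵐ(Tₙ(A))` as the candidate for the `n`-fold pullback of `Tᵐ(p_A)`. -/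
def powCone (m n : ℕ) (A : C) :
    WidePullbackCone fun _ : Fin n => (iterFunctor D.T m).map (D.p.app A) :=
  WidePullbackCone.mk ((iterFunctor D.T m).map ((D.base n).app A))
    (fun j => (iterFunctor D.T m).map ((D.q n j).app A))
    (fun j => by rw [← Functor.map_comp, D.q_p_app])

variable {D} in
/-- `u : X ⟶ T₂(A)` is the pairing `⟨f, g⟩` of `f, g : X ⟶ T(A)`.  (Once `T₂(A)` is the pullback of two
copies of `p_A`, there is exactly one such `u` whenever `f ≫ p_A = g ≫ p_A`.) -/
def IsPair {X A : C} (u : X ⟶ (D.Tn 2).obj A) (f g : X ⟶ D.T.obj A) : Prop :=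
  u ≫ (D.q 2 0).app A = f ∧ u ≫ (D.q 2 1).app A = g

variable {D} in
/-- `u : X ⟶ T(T₂(A))` is the pairing `⟨f, g⟩` of `f, g : X ⟶ T(T(A))`.  (Once `T(T₂(A))` is the pullback
of two copies of `T(p_A)`, there is exactly one such `u` whenever `f ≫ T(p_A) = g ≫ T(p_A)`.) -/
def IsTPair {X A : C} (u : X ⟶ D.T.obj ((D.Tn 2).obj A)) (f g : X ⟶ D.T.obj (D.T.obj A)) : Prop :=
  u ≫ D.T.map ((D.q 2 0).app A) = f ∧ u ≫ D.T.map ((D.q 2 1).app A) = g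

/-- The axioms of a Rosický tangent structure (composition `≫` is in diagrammatic order). -/
structure IsRosickyTangent : Prop where
  /-- `Tᵐ(Tₙ(A))` is the `n`-fold pullback of `Tᵐ(p_A)`; in particular `Tₙ(A)` is that of `p_A`. -/
  isLimit_pow : ∀ (m n : ℕ) (A : C), Nonempty (IsLimit (D.powCone m n A))
  -- `p_A` is an additive bundle, with sum `s` and zero `z`:
  s_p : ∀ A : C, D.s.app A ≫ D.p.app A = (D.base 2).app A
  z_p : ∀ A : C, D.z.app A ≫ D.p.app A = 𝟙 A
  s_assoc : ∀ {X A : C} (f g h : X ⟶ D.T.obj A) (u u' v v' : X ⟶ (D.Tn 2).obj A),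
    IsPair u f g → IsPair u' (u ≫ D.s.app A) h → IsPair v g h → IsPair v' f (v ≫ D.s.app A) →
      u' ≫ D.s.app A = v' ≫ D.s.app A
  s_comm : ∀ {X A : C} (f g : X ⟶ D.T.obj A) (u v : X ⟶ (D.Tn 2).obj A),
    IsPair u f g → IsPair v g f → u ≫ D.s.app A = v ≫ D.s.app A
  s_zero : ∀ {X A : C} (f : X ⟶ D.T.obj A) (u : X ⟶ (D.Tn 2).obj A),
    IsPair u f (f ≫ D.p.app A ≫ D.z.app A) → u ≫ D.s.app A = f
  -- `(l_A, z_A)` is a morphism of additive bundles from `p_A` to `T(p_A)`: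
  l_Tp : ∀ A : C, D.l.app A ≫ D.T.map (D.p.app A) = D.p.app A ≫ D.z.app A
  z_l : ∀ A : C, D.z.app A ≫ D.l.app A = D.z.app A ≫ D.T.map (D.z.app A)
  s_l : ∀ (A : C) (u : (D.Tn 2).obj A ⟶ D.T.obj ((D.Tn 2).obj A)),
    IsTPair u ((D.q 2 0).app A ≫ D.l.app A) ((D.q 2 1).app A ≫ D.l.app A) →
      D.s.app A ≫ D.l.app A = u ≫ D.T.map (D.s.app A)
  -- `(c_A, 1)` is a morphism of additive bundles from `T(p_A)` to `p_{T(A)}`: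
  c_p : ∀ A : C, D.c.app A ≫ D.p.app (D.T.obj A) = D.T.map (D.p.app A)
  Tz_c : ∀ A : C, D.T.map (D.z.app A) ≫ D.c.app A = D.z.app (D.T.obj A)
  Ts_c : ∀ (A : C) (u : D.T.obj ((D.Tn 2).obj A) ⟶ (D.Tn 2).obj (D.T.obj A)),
    IsPair u (D.T.map ((D.q 2 0).app A) ≫ D.c.app A) (D.T.map ((D.q 2 1).app A) ≫ D.c.app A) →
      D.T.map (D.s.app A) ≫ D.c.app A = u ≫ D.s.app (D.T.obj A)
  -- Coherence of `l` and `c`: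
  c_c : ∀ A : C, D.c.app A ≫ D.c.app A = 𝟙 _
  l_c : ∀ A : C, D.l.app A ≫ D.c.app A = D.l.app A
  l_l : ∀ A : C, D.l.app A ≫ D.T.map (D.l.app A) = D.l.app A ≫ D.l.app (D.T.obj A)
  c_c_c : ∀ A : C,
    D.T.map (D.c.app A) ≫ D.c.app (D.T.obj A) ≫ D.T.map (D.c.app A) =
      D.c.app (D.T.obj A) ≫ D.T.map (D.c.app A) ≫ D.c.app (D.T.obj A)
  l_c_c : ∀ A : C,
    D.l.app (D.T.obj A) ≫ D.T.map (D.c.app A) ≫ D.c.app (D.T.obj A) =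
      D.c.app A ≫ D.T.map (D.l.app A)
  /-- Universality of the vertical lift: for `u = ⟨l_A ∘ q₀, z_{T(A)} ∘ q₁⟩`, the map
  `T(s_A) ∘ u : T₂(A) ⟶ T²(A)` is the equalizer of `T(p_A)` and of `z_A ∘ p_A ∘ T(p_A)`, that is, the
  pullback of `z_A` along `T(p_A)`, and the powers of `T` preserve this pullback. -/
  universal : ∀ (A : C) (u : (D.Tn 2).obj A ⟶ D.T.obj ((D.Tn 2).obj A)),
    IsTPair u ((D.q 2 0).app A ≫ D.l.app A) ((D.q 2 1).app A ≫ D.z.app (D.T.obj A)) →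
      ∀ m : ℕ, IsPullback ((iterFunctor D.T m).map (u ≫ D.T.map (D.s.app A)))
        ((iterFunctor D.T m).map ((D.base 2).app A))
        ((iterFunctor D.T m).map (D.T.map (D.p.app A)))
        ((iterFunctor D.T m).map (D.z.app A))
  -- Negatives:
  neg_p : ∀ A : C, D.neg.app A ≫ D.p.app A = D.p.app A
  s_neg : ∀ (A : C) (u : D.T.obj A ⟶ (D.Tn 2).obj A),
    IsPair u (𝟙 _) (D.neg.app A) → u ≫ D.s.app A = D.p.app A ≫ D.z.app A

/-- A Cartesian Rosický tangent category: the category has finite products, and `T` preserves them. -/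
structure IsCartesianRosickyTangent : Prop extends D.IsRosickyTangent where
  hasFiniteProducts : HasFiniteProducts C
  isIso_piComparison : ∀ (n : ℕ) (A : Fin n → C), IsIso (piComparison D.T A)
  isIso_terminal : IsIso (terminal.from (D.T.obj (⊤_ C)))

end RosickyTangentData

/-! ### Symmetric operads in modules over a commutative ring -/

/-- The inputs of a partial composite `μ ∘ᵢ ν`, where `μ` has `m` inputs and `ν` has `n` inputs
(all inputs are numbered from `0`): they are the inputs of `μ` other than `i`, together with the
inputs of `ν`, which are inserted in order at the place of `i`. -/
def operadInputs {m n k : ℕ} (h : k + 1 = m + n) (i : Fin m) :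
    Fin k ≃ {j : Fin m // j ≠ i} ⊕ Fin n where
  toFun t :=
    if h₁ : t.1 < i.1 then
      Sum.inl ⟨⟨t.1, by omega⟩, fun e => by have := congrArg Fin.val e; simp at this; omega⟩
    else if h₂ : t.1 < i.1 + n then Sum.inr ⟨t.1 - i.1, by omega⟩
    else Sum.inl ⟨⟨t.1 + 1 - n, by omega⟩,
      fun e => by have := congrArg Fin.val e; simp at this; omega⟩
  invFun x :=
    match x with
    | Sum.inl j => if h₁ : j.1.1 < i.1 then ⟨j.1.1, by omega⟩ else ⟨j.1.1 + n - 1, by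
        have := j.1.2; have := i.2; have hne : j.1.1 ≠ i.1 := fun e => j.2 (Fin.ext e); omega⟩
    | Sum.inr t => ⟨i.1 + t.1, by omega⟩
  left_inv t := by
    have := i.2
    apply Fin.ext
    by_cases h₁ : t.1 < i.1
    · simp [h₁]
    · by_cases h₂ : t.1 < i.1 + n
      · simp [h₁, h₂]; omega
      · have h₃ : ¬ (t.1 + 1 - n < i.1) := by omega
        simp [h₁, h₂, h₃]; omega
  right_inv x := by
    rcases x with ⟨⟨j, hj⟩, hji⟩ | t
    · have hne : j ≠ i.1 := fun e => hji (Fin.ext e)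
      by_cases h₁ : j < i.1
      · simp [h₁]
      · have h₂ : ¬ (j + n - 1 < i.1) := by omega
        have h₃ : ¬ (j + n - 1 < i.1 + n) := by omega
        simp only [h₁, h₂, h₃, dite_false]
        congr 3
        omega
    · simp

/-- A (symmetric, algebraic) operad over a commutative ring `R`, presented by partial compositions:
a sequence of `R`-modules `P(n)`, each with a right action of the symmetric group `Σ(n)`, a unit in
`P(1)` and partial compositions `∘ᵢ : P(m) ⊗ P(n) → P(m + n - 1)`, which are unital, associative
and equivariant.  Inputs are numbered from `0`, and the arity `k = m + n - 1` of a composite is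
recorded by an equation `k + 1 = m + n`. -/
structure Operad (R : Type u) [CommRing R] where
  /-- The module `P(n)` of operations with `n` inputs. -/
  obj : ℕ → Type v
  [addCommGroup : ∀ n, AddCommGroup (obj n)]
  [module : ∀ n, Module R (obj n)]
  /-- The right action of the symmetric group: `act σ μ` is `μ · σ`. -/
  act : ∀ {n : ℕ}, Equiv.Perm (Fin n) → (obj n →ₗ[R] obj n)
  /-- The unit operation. -/
  one : obj 1
  /-- `circ h i μ ν` is the partial composition `μ ∘ᵢ ν`. -/
  circ : ∀ {m n k : ℕ}, k + 1 = m + n → Fin m → (obj m →ₗ[R] obj n →ₗ[R] obj k)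
  act_one : ∀ {n : ℕ} (μ : obj n), act 1 μ = μ
  act_mul : ∀ {n : ℕ} (σ τ : Equiv.Perm (Fin n)) (μ : obj n), act (σ * τ) μ = act τ (act σ μ)
  one_circ : ∀ {n : ℕ} (h : n + 1 = 1 + n) (i : Fin 1) (ν : obj n), circ h i one ν = ν
  circ_one : ∀ {m : ℕ} (h : m + 1 = m + 1) (i : Fin m) (μ : obj m), circ h i μ one = μ
  /-- Sequential associativity: `(lam ∘ᵢ μ) ∘ᵢ₊ⱼ ν = lam ∘ᵢ (μ ∘ⱼ ν)`. -/
  circ_sequential : ∀ {l m n a b r : ℕ} (h₁ : a + 1 = l + m) (h₂ : r + 1 = a + n)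
    (h₃ : b + 1 = m + n) (h₄ : r + 1 = l + b) (i : Fin l) (j : Fin m) (i' : Fin a)
    (_ : i'.1 = i.1 + j.1) (lam : obj l) (μ : obj m) (ν : obj n),
    circ h₂ i' (circ h₁ i lam μ) ν = circ h₄ i lam (circ h₃ j μ ν)
  /-- Parallel associativity: `(lam ∘ᵢ μ) ∘ⱼ₊ₘ₋₁ ν = (lam ∘ⱼ ν) ∘ᵢ μ` for `i < j`. -/
  circ_parallel : ∀ {l m n a b r : ℕ} (h₁ : a + 1 = l + m) (h₂ : r + 1 = a + n)
    (h₃ : b + 1 = l + n) (h₄ : r + 1 = b + m) (i j : Fin l) (_ : i < j) (j' : Fin a)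
    (_ : j'.1 + 1 = j.1 + m) (i' : Fin b) (_ : i'.1 = i.1) (lam : obj l) (μ : obj m) (ν : obj n),
    circ h₂ j' (circ h₁ i lam μ) ν = circ h₄ i' (circ h₃ j lam ν) μ
  /-- Equivariance in the second argument: `σ` acts on the block of inputs of `ν` only. -/
  circ_act : ∀ {m n k : ℕ} (h : k + 1 = m + n) (i : Fin m) (μ : obj m)
    (σ : Equiv.Perm (Fin n)) (ν : obj n),
    circ h i μ (act σ ν) =
      act ((operadInputs h i).trans
        ((Equiv.sumCongr (Equiv.refl _) σ).trans (operadInputs h i).symm)) (circ h i μ ν)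
  /-- Equivariance in the first argument: `(μ · σ) ∘ᵢ ν` is obtained from `μ ∘_{σ(i)} ν` by the
  block permutation that moves the inputs of `μ` as `σ` does and keeps the block of inputs of `ν`
  in order. -/
  act_circ : ∀ {m n k : ℕ} (h : k + 1 = m + n) (i : Fin m) (σ : Equiv.Perm (Fin m))
    (μ : obj m) (ν : obj n),
    circ h i (act σ μ) ν =
      act ((operadInputs h i).trans
        ((Equiv.sumCongr (σ.subtypeEquiv fun j => by simp) (Equiv.refl _)).trans
          (operadInputs h (σ i)).symm)) (circ h (σ i) μ ν)

attribute [instance] Operad.addCommGroup Operad.module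

namespace Operad

section

variable {R : Type u} [CommRing R] (P : Operad.{u, v} R)

/-- Auxiliary to `Operad.comp`: for `μ` with `k + r` inputs, compose `ν_{k-1}`, ..., `ν_0`, in this
order, into the first `k` inputs of `μ`. -/
def compAux : ∀ (k r : ℕ) {N : ℕ} (n : Fin k → ℕ) (_ : ∑ i, n i + r = N),
    P.obj (k + r) → (∀ i, P.obj (n i)) → P.obj N
  | 0, r, N, _, h, μ, _ => (show 0 + r = N by simpa using h) ▸ μ
  | k + 1, r, _, n, h, μ, ν =>
      compAux k (n (Fin.last k) + r) (fun i => n i.castSucc)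
        (by rw [← h, Fin.sum_univ_castSucc, add_assoc])
        (P.circ (k := k + (n (Fin.last k) + r)) (by omega) ⟨k, by omega⟩ μ (ν (Fin.last k)))
        (fun i => ν i.castSucc)

/-- The complete composition
`μ(ν₁, …, νₖ) = (⋯((μ ∘ₖ νₖ) ∘ₖ₋₁ νₖ₋₁)⋯) ∘₁ ν₁`, an operation with `n₁ + ⋯ + nₖ` inputs. -/
def comp {k : ℕ} {n : Fin k → ℕ} (μ : P.obj k) (ν : ∀ i, P.obj (n i)) : P.obj (∑ i, n i) :=
  P.compAux k 0 n rfl μ ν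

/-- The concatenation `(a₁₁, …, a₁ₙ₁, …, aₖ₁, …, aₖₙₖ)` of `k` tuples. -/
def flatten {V : Type*} {k : ℕ} {n : Fin k → ℕ} (a : ∀ i, Fin (n i) → V) :
    Fin (∑ i, n i) → V :=
  fun t => a (finSigmaFinEquiv.symm t).1 (finSigmaFinEquiv.symm t).2

/-! ### The module `S(P, V)` -/

/-- The submodule of `P(n) ⊗ V^{⊗ n}` whose quotient is the module of coinvariants for the diagonal
action of `Σ(n)`. -/
def coinvRel (V : Type w) [AddCommGroup V] [Module R V] (n : ℕ) :
    Submodule R (P.obj n ⊗[R] (⨂[R] (_ : Fin n), V)) :=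
  Submodule.span R {x | ∃ (σ : Equiv.Perm (Fin n)) (μ : P.obj n) (a : Fin n → V),
    x = P.act σ μ ⊗ₜ[R] PiTensorProduct.tprod R a -
      μ ⊗ₜ[R] PiTensorProduct.tprod R (fun i => a (σ⁻¹ i))}

/-- `S(P, V) = ⨁ₙ (P(n) ⊗ V^{⊗ n})_{Σ(n)}`. -/
abbrev S (V : Type w) [AddCommGroup V] [Module R V] : Type (max u v w) :=
  DirectSum ℕ fun n => (P.obj n ⊗[R] (⨂[R] (_ : Fin n), V)) ⧸ P.coinvRel V n

variable {P}

/-- The element `(μ; a₁, …, aₙ)` of `S(P, V)`, as a multilinear function of `a₁, …, aₙ`. -/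
def cls {V : Type w} [AddCommGroup V] [Module R V] {n : ℕ} (μ : P.obj n) :
    MultilinearMap R (fun _ : Fin n => V) (P.S V) :=
  ((DirectSum.lof R ℕ (fun n => (P.obj n ⊗[R] (⨂[R] (_ : Fin n), V)) ⧸ P.coinvRel V n) n ∘ₗ
    (P.coinvRel V n).mkQ) ∘ₗ TensorProduct.mk R (P.obj n) (⨂[R] (_ : Fin n), V) μ).compMultilinearMap
    (PiTensorProduct.tprod R)

section lemmas

variable {V : Type w} [AddCommGroup V] [Module R V]

theorem cls_add {n : ℕ} (μ μ' : P.obj n) (a : Fin n → V) :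
    cls (μ + μ') a = cls μ a + cls μ' a := by
  simp [cls]

theorem cls_smul {n : ℕ} (r : R) (μ : P.obj n) (a : Fin n → V) :
    cls (r • μ) a = r • cls μ a := by
  simp [cls]

theorem cls_act {n : ℕ} (σ : Equiv.Perm (Fin n)) (μ : P.obj n) (a : Fin n → V) :
    cls (P.act σ μ) a = cls μ (fun i => a (σ⁻¹ i)) := by
  simp only [cls, LinearMap.compMultilinearMap_apply, LinearMap.comp_apply, TensorProduct.mk_apply]
  congr 1
  rw [← sub_eq_zero, ← map_sub, Submodule.mkQ_apply, Submodule.Quotient.mk_eq_zero]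
  exact Submodule.subset_span ⟨σ, μ, a, rfl⟩

/-- A family of `R`-multilinear operations, linear and equivariant in `P(n)`, is the same as an
`R`-linear map out of `S(P, V)`. -/
def liftS {W : Type*} [AddCommGroup W] [Module R W]
    (φ : ∀ n, P.obj n →ₗ[R] MultilinearMap R (fun _ : Fin n => V) W)
    (hφ : ∀ n (σ : Equiv.Perm (Fin n)) (μ : P.obj n) (a : Fin n → V),
      φ n (P.act σ μ) a = φ n μ (fun i => a (σ⁻¹ i))) : P.S V →ₗ[R] W :=
  DirectSum.toModule R ℕ W fun n =>
    (P.coinvRel V n).liftQ (TensorProduct.lift (PiTensorProduct.lift.toLinearMap ∘ₗ φ n)) (by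
      rw [coinvRel, Submodule.span_le]
      rintro _ ⟨σ, μ, a, rfl⟩
      simp [hφ])

theorem liftS_cls {W : Type*} [AddCommGroup W] [Module R W]
    (φ : ∀ n, P.obj n →ₗ[R] MultilinearMap R (fun _ : Fin n => V) W)
    (hφ : ∀ n (σ : Equiv.Perm (Fin n)) (μ : P.obj n) (a : Fin n → V),
      φ n (P.act σ μ) a = φ n μ (fun i => a (σ⁻¹ i))) {n : ℕ} (μ : P.obj n) (a : Fin n → V) :
    liftS φ hφ (cls μ a) = φ n μ a := by
  simp [liftS, cls]

end lemmas

end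

end Operad

/-! ### Algebras over an operad -/

/-- An algebra over the operad `P`: an `R`-module `A` with an `R`-linear map `θ : S(P, A) → A` such
that, writing `μ(a₁, …, aₙ) = θ(μ; a₁, …, aₙ)`, one has `1(a) = a` and
`μ(ν₁(a₁₁, …), …, νₖ(aₖ₁, …)) = μ(ν₁, …, νₖ)(a₁₁, …, aₖₙₖ)`.  As `S(P, A)` is spanned by the
elements `(μ; a₁, …, aₙ)`, these are the unit and associativity laws of an algebra over the monad
`S(P, -)`. -/
structure OperadAlgebra {R : Type u} [CommRing R] (P : Operad.{u, v} R) where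
  /-- The underlying module. -/
  carrier : Type w
  [addCommGroup : AddCommGroup carrier]
  [module : Module R carrier]
  /-- The structure map. -/
  θ : P.S carrier →ₗ[R] carrier
  θ_one : ∀ a : carrier, θ (Operad.cls P.one fun _ => a) = a
  θ_comp : ∀ {k : ℕ} {n : Fin k → ℕ} (μ : P.obj k) (ν : ∀ i, P.obj (n i))
    (a : ∀ i, Fin (n i) → carrier),
    θ (Operad.cls μ fun i => θ (Operad.cls (ν i) (a i))) =
      θ (Operad.cls (P.comp μ ν) (Operad.flatten a))

attribute [instance] OperadAlgebra.addCommGroup OperadAlgebra.module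

namespace OperadAlgebra

section

variable {R : Type u} [CommRing R] {P : Operad.{u, v} R}

/-- The operation `μ(a₁, …, aₙ)` of a `P`-algebra. -/
def op (A : OperadAlgebra.{u, v, w} P) {n : ℕ} (μ : P.obj n) :
    MultilinearMap R (fun _ : Fin n => A.carrier) A.carrier :=
  A.θ.compMultilinearMap (Operad.cls μ)

section lemmas

variable (A : OperadAlgebra.{u, v, w} P)

theorem op_add {n : ℕ} (μ μ' : P.obj n) : A.op (μ + μ') = A.op μ + A.op μ' := by
  ext a; simp [op, Operad.cls_add]

theorem op_smul {n : ℕ} (r : R) (μ : P.obj n) : A.op (r • μ) = r • A.op μ := by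
  ext a; simp [op, Operad.cls_smul]

theorem op_act {n : ℕ} (σ : Equiv.Perm (Fin n)) (μ : P.obj n) (a : Fin n → A.carrier) :
    A.op (P.act σ μ) a = A.op μ (fun i => a (σ⁻¹ i)) := by
  simp [op, Operad.cls_act]

theorem op_one (a : Fin 1 → A.carrier) : A.op P.one a = a 0 := by
  have : a = fun _ => a 0 := by ext i; rw [Subsingleton.elim i 0]
  rw [this]; exact A.θ_one (a 0)

theorem op_comp {k : ℕ} {n : Fin k → ℕ} (μ : P.obj k) (ν : ∀ i, P.obj (n i))
    (a : ∀ i, Fin (n i) → A.carrier) :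
    A.op μ (fun i => A.op (ν i) (a i)) = A.op (P.comp μ ν) (Operad.flatten a) :=
  A.θ_comp μ ν a

end lemmas

/-- A `P`-algebra from its family of operations. -/
def ofOps (X : Type w) [AddCommGroup X] [Module R X]
    (φ : ∀ n, P.obj n →ₗ[R] MultilinearMap R (fun _ : Fin n => X) X)
    (hact : ∀ n (σ : Equiv.Perm (Fin n)) (μ : P.obj n) (a : Fin n → X),
      φ n (P.act σ μ) a = φ n μ (fun i => a (σ⁻¹ i)))
    (hone : ∀ a : X, φ 1 P.one (fun _ => a) = a)
    (hcomp : ∀ {k : ℕ} {n : Fin k → ℕ} (μ : P.obj k) (ν : ∀ i, P.obj (n i))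
      (a : ∀ i, Fin (n i) → X),
      φ k μ (fun i => φ (n i) (ν i) (a i)) = φ _ (P.comp μ ν) (Operad.flatten a)) :
    OperadAlgebra.{u, v, w} P where
  carrier := X
  θ := Operad.liftS φ hact
  θ_one a := by rw [Operad.liftS_cls, hone]
  θ_comp μ ν a := by simp only [Operad.liftS_cls, hcomp]

/-- A morphism of `P`-algebras: an `R`-linear map `f` with `f(μ(a₁, …, aₙ)) = μ(f(a₁), …, f(aₙ))`. -/
@[ext]
structure Hom (A B : OperadAlgebra.{u, v, w} P) where
  /-- The underlying linear map. -/
  toLinearMap : A.carrier →ₗ[R] B.carrier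
  map_op : ∀ {n : ℕ} (μ : P.obj n) (a : Fin n → A.carrier),
    toLinearMap (A.op μ a) = B.op μ (fun i => toLinearMap (a i))

/-- The category `ALG_P` of `P`-algebras. -/
instance : Category (OperadAlgebra.{u, v, w} P) where
  Hom := Hom
  id A := ⟨LinearMap.id, fun _ _ => rfl⟩
  comp f g := ⟨g.toLinearMap ∘ₗ f.toLinearMap, fun μ a => by simp [f.map_op, g.map_op]⟩

@[ext]
theorem hom_ext {A B : OperadAlgebra.{u, v, w} P} {f g : A ⟶ B}
    (h : ∀ a, f.toLinearMap a = g.toLinearMap a) : f = g :=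
  Hom.ext (LinearMap.ext h)

@[simp]
theorem id_apply (A : OperadAlgebra.{u, v, w} P) (a : A.carrier) :
    (𝟙 A : A ⟶ A).toLinearMap a = a := rfl

@[simp]
theorem comp_apply {A B C : OperadAlgebra.{u, v, w} P} (f : A ⟶ B) (g : B ⟶ C) (a : A.carrier) :
    (f ≫ g).toLinearMap a = g.toLinearMap (f.toLinearMap a) := rfl

/-! ### Semi-direct products -/

/-- For linear maps `f, g : X → A`, the multilinear map
`(x₁, …, xₙ) ↦ ∑ᵢ μ(f(x₁), …, g(xᵢ), …, f(xₙ))`. -/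
def derivOp (A : OperadAlgebra.{u, v, w} P) {X : Type w} [AddCommGroup X] [Module R X]
    (f g : X →ₗ[R] A.carrier) {n : ℕ} (μ : P.obj n) :
    MultilinearMap R (fun _ : Fin n => X) A.carrier :=
  ∑ i, (A.op μ).compLinearMap fun j => if j = i then g else f

section lemmas

variable (A : OperadAlgebra.{u, v, w} P) {X : Type w} [AddCommGroup X] [Module R X]
  (f g : X →ₗ[R] A.carrier)

theorem derivOp_apply {n : ℕ} (μ : P.obj n) (x : Fin n → X) :
    A.derivOp f g μ x = ∑ i, A.op μ fun j => if j = i then g (x j) else f (x j) := by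
  simp only [derivOp, sum_apply, MultilinearMap.compLinearMap_apply]
  refine Finset.sum_congr rfl fun i _ => ?_
  congr 1
  ext j
  split_ifs <;> rfl

theorem derivOp_add {n : ℕ} (μ μ' : P.obj n) :
    A.derivOp f g (μ + μ') = A.derivOp f g μ + A.derivOp f g μ' := by
  ext x; simp [derivOp_apply, op_add, Finset.sum_add_distrib]

theorem derivOp_smul {n : ℕ} (r : R) (μ : P.obj n) :
    A.derivOp f g (r • μ) = r • A.derivOp f g μ := by
  ext x; simp [derivOp_apply, op_smul, Finset.smul_sum]

theorem derivOp_act {n : ℕ} (σ : Equiv.Perm (Fin n)) (μ : P.obj n) (x : Fin n → X) :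
    A.derivOp f g (P.act σ μ) x = A.derivOp f g μ (fun i => x (σ⁻¹ i)) := by
  simp only [derivOp_apply, op_act]
  refine Fintype.sum_equiv σ _ _ fun i => ?_
  congr 1
  ext j
  simp [Equiv.symm_apply_eq]

theorem derivOp_one (x : X) : A.derivOp f g P.one (fun _ => x) = g x := by
  simp [derivOp_apply, op_one]

theorem derivOp_comp {k : ℕ} {n : Fin k → ℕ} (μ : P.obj k) (ν : ∀ i, P.obj (n i))
    (x : ∀ i, Fin (n i) → X) (y : Fin k → X)
    (hf : ∀ i, f (y i) = A.op (ν i) fun t => f (x i t))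
    (hg : ∀ i, g (y i) = A.derivOp f g (ν i) (x i)) :
    A.derivOp f g μ y = A.derivOp f g (P.comp μ ν) (Operad.flatten x) := by
  rw [derivOp_apply, derivOp_apply, ← finSigmaFinEquiv.sum_comp, Fintype.sum_sigma]
  refine Finset.sum_congr rfl fun i _ => ?_
  have h₁ : (fun j => if j = i then g (y j) else f (y j)) =
      Function.update (fun j => f (y j)) i (∑ t, A.op (ν i) fun s =>
        if s = t then g (x i s) else f (x i s)) := by
    ext j
    by_cases h : j = i
    · subst h; simp [hg, derivOp_apply]
    · simp [h]
  rw [h₁, MultilinearMap.map_update_sum]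
  refine Finset.sum_congr rfl fun t _ => ?_
  have h₂ : Function.update (fun j => f (y j)) i (A.op (ν i) fun s =>
        if s = t then g (x i s) else f (x i s)) =
      fun j => A.op (ν j) fun s => if (⟨j, s⟩ : (i : Fin k) × Fin (n i)) = ⟨i, t⟩
        then g (x j s) else f (x j s) := by
    ext j
    by_cases h : j = i
    · subst h; simp
    · simp [h, hf]
  rw [h₂, op_comp]
  congr 1
  ext s
  simp [Operad.flatten, Equiv.symm_apply_eq]

end lemmas

/-- The operations `μ((a₁, b₁), …, (aₙ, bₙ)) = (μ(a₁, …, aₙ), ∑ᵢ μ(a₁, …, bᵢ, …, aₙ))` on `A × A`. -/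
def semidirectOps (A : OperadAlgebra.{u, v, w} P) (n : ℕ) : P.obj n →ₗ[R]
    MultilinearMap R (fun _ : Fin n => A.carrier × A.carrier) (A.carrier × A.carrier) where
  toFun μ := ((A.op μ).compLinearMap fun _ => LinearMap.fst R _ _).prod
    (A.derivOp (LinearMap.fst R _ _) (LinearMap.snd R _ _) μ)
  map_add' μ μ' := by ext x <;> simp [op_add, derivOp_add]
  map_smul' r μ := by ext x <;> simp [op_smul, derivOp_smul]

/-- The operations `μ((a₁, b₁), …, (aₘ, bₘ)) = (μ(a₁, …, aₘ), (∑ᵢ μ(a₁, …, b_{i,j}, …, aₘ))ⱼ)` on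
`A × Aⁿ`. -/
def semidirectPowOps (A : OperadAlgebra.{u, v, w} P) (n m : ℕ) : P.obj m →ₗ[R]
    MultilinearMap R (fun _ : Fin m => A.carrier × (Fin n → A.carrier))
      (A.carrier × (Fin n → A.carrier)) where
  toFun μ := ((A.op μ).compLinearMap fun _ => LinearMap.fst R _ _).prod
    (MultilinearMap.pi fun j : Fin n =>
      A.derivOp (LinearMap.fst R _ _) (LinearMap.proj j ∘ₗ LinearMap.snd R _ _) μ)
  map_add' μ μ' := by ext x <;> simp [op_add, derivOp_add]
  map_smul' r μ := by ext x <;> simp [op_smul, derivOp_smul]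

section lemmas

variable (A : OperadAlgebra.{u, v, w} P)

theorem semidirectOps_apply {m : ℕ} (μ : P.obj m) (x : Fin m → A.carrier × A.carrier) :
    A.semidirectOps m μ x = (A.op μ fun i => (x i).1,
      A.derivOp (LinearMap.fst R _ _) (LinearMap.snd R _ _) μ x) := rfl

theorem semidirectPowOps_apply (n : ℕ) {m : ℕ} (μ : P.obj m)
    (x : Fin m → A.carrier × (Fin n → A.carrier)) :
    A.semidirectPowOps n m μ x = (A.op μ fun i => (x i).1, fun j =>
      A.derivOp (LinearMap.fst R _ _) (LinearMap.proj j ∘ₗ LinearMap.snd R _ _) μ x) := rfl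

theorem semidirectOps_act (n : ℕ) (σ : Equiv.Perm (Fin n)) (μ : P.obj n)
    (a : Fin n → A.carrier × A.carrier) :
    A.semidirectOps n (P.act σ μ) a = A.semidirectOps n μ (fun i => a (σ⁻¹ i)) := by
  simp only [semidirectOps_apply, op_act, derivOp_act]

theorem semidirectPowOps_act (m n : ℕ) (σ : Equiv.Perm (Fin n)) (μ : P.obj n)
    (a : Fin n → A.carrier × (Fin m → A.carrier)) :
    A.semidirectPowOps m n (P.act σ μ) a = A.semidirectPowOps m n μ (fun i => a (σ⁻¹ i)) := by
  simp only [semidirectPowOps_apply, op_act, derivOp_act]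

end lemmas

/-- The semi-direct product `A ⋉ A`: the module `A × A` with
`μ((a₁, b₁), …, (aₙ, bₙ)) = (μ(a₁, …, aₙ), ∑ᵢ μ(a₁, …, bᵢ, …, aₙ))`. -/
def semidirect (A : OperadAlgebra.{u, v, w} P) : OperadAlgebra.{u, v, w} P :=
  ofOps (A.carrier × A.carrier) A.semidirectOps
    A.semidirectOps_act
    (fun a => by simp only [semidirectOps_apply, op_one, derivOp_one]; rfl)
    (fun μ ν a => by
      rw [semidirectOps_apply, semidirectOps_apply]
      refine Prod.ext ?_ ?_
      · exact A.op_comp μ ν fun i t => (a i t).1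
      · exact A.derivOp_comp _ _ μ ν a _ (fun i => rfl) (fun i => rfl))

/-- The semi-direct product `A ⋉ Aⁿ`: the module `A × Aⁿ` with
`μ((a₁, b₁), …, (aₘ, bₘ)) = (μ(a₁, …, aₘ), (∑ᵢ μ(a₁, …, b_{i,j}, …, aₘ))ⱼ)`. -/
def semidirectPow (A : OperadAlgebra.{u, v, w} P) (n : ℕ) : OperadAlgebra.{u, v, w} P :=
  ofOps (A.carrier × (Fin n → A.carrier)) (A.semidirectPowOps n)
    (A.semidirectPowOps_act n)
    (fun a => by simp only [semidirectPowOps_apply, op_one, derivOp_one]; rfl)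
    (fun μ ν a => by
      rw [semidirectPowOps_apply, semidirectPowOps_apply]
      refine Prod.ext ?_ (funext fun j => ?_)
      · exact A.op_comp μ ν fun i t => (a i t).1
      · exact A.derivOp_comp _ _ μ ν a _ (fun i => rfl) (fun i => rfl))

section lemmas

variable (A : OperadAlgebra.{u, v, w} P)

theorem semidirect_op {m : ℕ} (μ : P.obj m) (x : Fin m → A.semidirect.carrier) :
    A.semidirect.op μ x = A.semidirectOps m μ x :=
  Operad.liftS_cls A.semidirectOps A.semidirectOps_act μ x

theorem semidirectPow_op (n : ℕ) {m : ℕ} (μ : P.obj m) (x : Fin m → (A.semidirectPow n).carrier) :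
    (A.semidirectPow n).op μ x = A.semidirectPowOps n m μ x :=
  Operad.liftS_cls (A.semidirectPowOps n) (A.semidirectPowOps_act n) μ x

theorem update_eq {m : ℕ} {V : Type*} (b c : Fin m → V) (i : Fin m) :
    (fun j => if j = i then b j else c j) = Function.update c i (b i) := by
  ext j
  by_cases h : j = i
  · subst h; simp
  · simp [h]

end lemmas

/-- The first component `(a, b) ↦ a`, as a linear map. -/
def sdFst (A : OperadAlgebra.{u, v, w} P) : A.semidirect.carrier →ₗ[R] A.carrier :=
  LinearMap.fst R A.carrier A.carrier

/-- The second component `(a, b) ↦ b`, as a linear map. -/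
def sdSnd (A : OperadAlgebra.{u, v, w} P) : A.semidirect.carrier →ₗ[R] A.carrier :=
  LinearMap.snd R A.carrier A.carrier

/-- The linear map `x ↦ (f(x), g(x))` into `A ⋉ A`. -/
def sdPair {A : OperadAlgebra.{u, v, w} P} {X : Type w} [AddCommGroup X] [Module R X]
    (f g : X →ₗ[R] A.carrier) : X →ₗ[R] A.semidirect.carrier :=
  LinearMap.prod f g

/-- The first component `(a, b₁, …, bₙ) ↦ a`, as a linear map. -/
def powFst (A : OperadAlgebra.{u, v, w} P) (n : ℕ) : (A.semidirectPow n).carrier →ₗ[R] A.carrier :=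
  LinearMap.fst R A.carrier (Fin n → A.carrier)

/-- The component `(a, b₁, …, bₙ) ↦ bⱼ`, as a linear map. -/
def powSnd (A : OperadAlgebra.{u, v, w} P) (n : ℕ) (j : Fin n) :
    (A.semidirectPow n).carrier →ₗ[R] A.carrier :=
  LinearMap.proj j ∘ₗ LinearMap.snd R A.carrier (Fin n → A.carrier)

/-- The linear map `x ↦ (f(x), g₁(x), …, gₙ(x))` into `A ⋉ Aⁿ`. -/
def powPair {A : OperadAlgebra.{u, v, w} P} {n : ℕ} {X : Type w} [AddCommGroup X] [Module R X]
    (f : X →ₗ[R] A.carrier) (g : Fin n → (X →ₗ[R] A.carrier)) :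
    X →ₗ[R] (A.semidirectPow n).carrier :=
  LinearMap.prod f (LinearMap.pi g)

section lemmas

variable {A : OperadAlgebra.{u, v, w} P}

theorem sd_ext {x y : A.semidirect.carrier} (h₁ : A.sdFst x = A.sdFst y)
    (h₂ : A.sdSnd x = A.sdSnd y) : x = y :=
  Prod.ext h₁ h₂

theorem pow_ext {n : ℕ} {x y : (A.semidirectPow n).carrier} (h₁ : A.powFst n x = A.powFst n y)
    (h₂ : ∀ j, A.powSnd n j x = A.powSnd n j y) : x = y :=
  Prod.ext h₁ (funext h₂)

@[simp]
theorem sdFst_op {m : ℕ} (μ : P.obj m) (x : Fin m → A.semidirect.carrier) :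
    A.sdFst (A.semidirect.op μ x) = A.op μ fun i => A.sdFst (x i) :=
  congrArg (α := A.carrier × A.carrier) Prod.fst (A.semidirect_op μ x)

@[simp]
theorem sdSnd_op {m : ℕ} (μ : P.obj m) (x : Fin m → A.semidirect.carrier) :
    A.sdSnd (A.semidirect.op μ x) =
      ∑ i, A.op μ fun j => if j = i then A.sdSnd (x j) else A.sdFst (x j) :=
  (congrArg (α := A.carrier × A.carrier) Prod.snd (A.semidirect_op μ x)).trans
    (derivOp_apply _ _ _ _ _)

@[simp]
theorem powFst_op {n m : ℕ} (μ : P.obj m) (x : Fin m → (A.semidirectPow n).carrier) :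
    A.powFst n ((A.semidirectPow n).op μ x) = A.op μ fun i => A.powFst n (x i) :=
  congrArg (α := A.carrier × (Fin n → A.carrier)) Prod.fst (A.semidirectPow_op n μ x)

@[simp]
theorem powSnd_op {n m : ℕ} (t : Fin n) (μ : P.obj m) (x : Fin m → (A.semidirectPow n).carrier) :
    A.powSnd n t ((A.semidirectPow n).op μ x) =
      ∑ i, A.op μ fun j => if j = i then A.powSnd n t (x j) else A.powFst n (x j) :=
  (congrArg (α := A.carrier × (Fin n → A.carrier)) (fun y => y.2 t)
    (A.semidirectPow_op n μ x)).trans (derivOp_apply _ _ _ _ _)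

variable {X : Type w} [AddCommGroup X] [Module R X]

@[simp]
theorem sdFst_pair (f g : X →ₗ[R] A.carrier) (x : X) : A.sdFst (sdPair f g x) = f x := rfl

@[simp]
theorem sdSnd_pair (f g : X →ₗ[R] A.carrier) (x : X) : A.sdSnd (sdPair f g x) = g x := rfl

@[simp]
theorem powFst_pair {n : ℕ} (f : X →ₗ[R] A.carrier) (g : Fin n → (X →ₗ[R] A.carrier)) (x : X) :
    A.powFst n (powPair f g x) = f x := rfl

@[simp]
theorem powSnd_pair {n : ℕ} (f : X →ₗ[R] A.carrier) (g : Fin n → (X →ₗ[R] A.carrier)) (x : X)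
    (j : Fin n) : A.powSnd n j (powPair f g x) = g j x := rfl

end lemmas

/-- A morphism `B → A ⋉ A` with given components `f` and `g`: `f` has to be a morphism of algebras,
and `g` a derivation along `f`. -/
def toSemidirect {A B : OperadAlgebra.{u, v, w} P} (f g : B.carrier →ₗ[R] A.carrier)
    (hf : ∀ {m : ℕ} (μ : P.obj m) (x : Fin m → B.carrier),
      f (B.op μ x) = A.op μ fun i => f (x i))
    (hg : ∀ {m : ℕ} (μ : P.obj m) (x : Fin m → B.carrier),
      g (B.op μ x) = ∑ i, A.op μ fun j => if j = i then g (x j) else f (x j)) :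
    B ⟶ A.semidirect :=
  Hom.mk (A := B) (B := A.semidirect) (sdPair f g) fun μ x =>
    sd_ext (by simp [hf]) (by simp [hg])

/-- A morphism `B → A ⋉ Aⁿ` with given components. -/
def toSemidirectPow {A B : OperadAlgebra.{u, v, w} P} (n : ℕ) (f : B.carrier →ₗ[R] A.carrier)
    (g : Fin n → (B.carrier →ₗ[R] A.carrier))
    (hf : ∀ {m : ℕ} (μ : P.obj m) (x : Fin m → B.carrier),
      f (B.op μ x) = A.op μ fun i => f (x i))
    (hg : ∀ (t : Fin n) {m : ℕ} (μ : P.obj m) (x : Fin m → B.carrier),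
      g t (B.op μ x) = ∑ i, A.op μ fun j => if j = i then g t (x j) else f (x j)) :
    B ⟶ A.semidirectPow n :=
  Hom.mk (A := B) (B := A.semidirectPow n) (powPair f g) fun μ x =>
    pow_ext (by simp [hf]) (by simp [hg])

/-! ### The tangent structure maps -/

section maps

variable (P)

/-- The tangent bundle functor: `T(A) = A ⋉ A` and `T(f)(a, b) = (f(a), f(b))`. -/
def tangentFunctor : OperadAlgebra.{u, v, w} P ⥤ OperadAlgebra.{u, v, w} P where
  obj A := A.semidirect
  map {A B} f := toSemidirect (A := B) (B := A.semidirect)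
    (f.toLinearMap ∘ₗ A.sdFst) (f.toLinearMap ∘ₗ A.sdSnd)
    (fun μ x => by simp [f.map_op])
    (fun μ x => by simp [f.map_op, apply_ite f.toLinearMap])

/-- The functor `Tₙ(A) = A ⋉ Aⁿ`, with `Tₙ(f)(a, b₁, …, bₙ) = (f(a), f(b₁), …, f(bₙ))`. -/
def tangentPowFunctor (n : ℕ) : OperadAlgebra.{u, v, w} P ⥤ OperadAlgebra.{u, v, w} P where
  obj A := A.semidirectPow n
  map {A B} f := toSemidirectPow (A := B) (B := A.semidirectPow n) n
    (f.toLinearMap ∘ₗ A.powFst n) (fun j => f.toLinearMap ∘ₗ A.powSnd n j)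
    (fun μ x => by simp [f.map_op])
    (fun t _ μ x => by simp [f.map_op, apply_ite f.toLinearMap])

/-- The projection `p(a, b) = a`. -/
def tangentProj : tangentFunctor.{u, v, w} P ⟶ 𝟭 _ where
  app A := Hom.mk (A := A.semidirect) (B := A) A.sdFst sdFst_op

/-- The projection `A ⋉ Aⁿ → A`, `(a, b₁, …, bₙ) ↦ a`. -/
def tangentPowBase (n : ℕ) : tangentPowFunctor.{u, v, w} P n ⟶ 𝟭 _ where
  app A := Hom.mk (A := A.semidirectPow n) (B := A) (A.powFst n) powFst_op

/-- The projection `qⱼ(a, b₁, …, bₙ) = (a, bⱼ)`. -/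
def tangentPowProj (n : ℕ) (j : Fin n) :
    tangentPowFunctor.{u, v, w} P n ⟶ tangentFunctor.{u, v, w} P where
  app A := toSemidirect (A := A) (B := A.semidirectPow n) (A.powFst n) (A.powSnd n j)
    powFst_op (powSnd_op j)

/-- The sum `s(a, b₁, b₂) = (a, b₁ + b₂)`. -/
def tangentSum : tangentPowFunctor.{u, v, w} P 2 ⟶ tangentFunctor.{u, v, w} P where
  app A := toSemidirect (A := A) (B := A.semidirectPow 2)
    (A.powFst 2) (A.powSnd 2 0 + A.powSnd 2 1)
    powFst_op
    (fun μ x => by simp [update_eq, Finset.sum_add_distrib])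
  naturality A B f := by
    ext a
    exact sd_ext rfl (map_add f.toLinearMap _ _).symm

/-- The zero map `z(a) = (a, 0)`. -/
def tangentZero : 𝟭 _ ⟶ tangentFunctor.{u, v, w} P where
  app A := toSemidirect (A := A) (B := A) LinearMap.id 0
    (fun μ x => rfl)
    (fun μ x => (Finset.sum_eq_zero fun i _ => (A.op μ).map_coord_zero i (by simp)).symm)
  naturality A B f := by
    ext a
    exact sd_ext rfl (map_zero f.toLinearMap).symm

/-- The vertical lift `l(a, b) = (a, 0, 0, b)`, where `(a, b, c, d)` denotes the element
`((a, b), (c, d))` of `(A ⋉ A) ⋉ (A ⋉ A)`. -/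
def tangentLift :
    tangentFunctor.{u, v, w} P ⟶ tangentFunctor.{u, v, w} P ⋙ tangentFunctor.{u, v, w} P where
  app A := toSemidirect (A := A.semidirect) (B := A.semidirect)
    (sdPair A.sdFst 0) (sdPair 0 A.sdSnd)
    (fun μ x => by
      refine sd_ext (by simp) ?_
      simp only [sdSnd_pair, sdSnd_op, sdFst_pair, LinearMap.zero_apply]
      exact (Finset.sum_eq_zero fun i _ => (A.op μ).map_coord_zero i (by simp)).symm)
    (fun μ x => by
      refine sd_ext ?_ ?_
      · simp only [map_sum, sdFst_op, sdFst_pair, LinearMap.zero_apply]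
        exact (Finset.sum_eq_zero fun i _ => (A.op μ).map_coord_zero i (by simp)).symm
      · simp only [map_sum, sdSnd_pair, sdSnd_op]
        refine Finset.sum_congr rfl fun i _ => ?_
        rw [Finset.sum_eq_single i (fun k _ hk => ?_) (by simp)]
        · congr 1
          ext j
          by_cases hj : j = i <;> simp [hj]
        · exact (A.op μ).map_coord_zero i (by simp [hk.symm]))
  naturality A B f := by
    ext a
    exact sd_ext (sd_ext rfl (map_zero f.toLinearMap).symm)
      (sd_ext (map_zero f.toLinearMap).symm rfl)

/-- The canonical flip `c(a, b, c, d) = (a, c, b, d)`. -/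
def tangentFlip : tangentFunctor.{u, v, w} P ⋙ tangentFunctor.{u, v, w} P ⟶
    tangentFunctor.{u, v, w} P ⋙ tangentFunctor.{u, v, w} P where
  app A := toSemidirect (A := A.semidirect) (B := A.semidirect.semidirect)
    (sdPair (A.sdFst ∘ₗ A.semidirect.sdFst) (A.sdFst ∘ₗ A.semidirect.sdSnd))
    (sdPair (A.sdSnd ∘ₗ A.semidirect.sdFst) (A.sdSnd ∘ₗ A.semidirect.sdSnd))
    (fun μ x => sd_ext (by simp) (by simp [apply_ite A.sdFst]))
    (fun μ x => by
      refine sd_ext (by simp [apply_ite A.sdFst]) ?_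
      simp only [sdSnd_pair, LinearMap.comp_apply, sdSnd_op, map_sum]
      rw [Finset.sum_comm]
      refine Finset.sum_congr rfl fun k _ => Finset.sum_congr rfl fun i _ => ?_
      congr 1
      ext j
      split_ifs <;> rfl)

/-- The negative map `n(a, b) = (a, -b)`. -/
def tangentNeg : tangentFunctor.{u, v, w} P ⟶ tangentFunctor.{u, v, w} P where
  app A := toSemidirect (A := A) (B := A.semidirect) A.sdFst (-A.sdSnd)
    sdFst_op
    (fun μ x => by simp [update_eq])
  naturality A B f := by
    ext a
    exact sd_ext rfl (map_neg f.toLinearMap _).symm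

/-- The septuple `(T, p, s, z, l, c, n)` on `ALG_P`, with `Tₙ(A) = A ⋉ Aⁿ`. -/
def tangentData : RosickyTangentData (OperadAlgebra.{u, v, w} P) where
  T := tangentFunctor P
  p := tangentProj P
  Tn := tangentPowFunctor P
  base := tangentPowBase P
  q := tangentPowProj P
  q_p _ _ := rfl
  s := tangentSum P
  z := tangentZero P
  l := tangentLift P
  c := tangentFlip P
  neg := tangentNeg P

end maps

end

end OperadAlgebra

namespace OperadAlgebra

variable {R : Type u} [CommRing R] {P : Operad.{u, v} R}

/-! ### Lifting through jointly injective families -/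

/-! Limits of algebras are computed on underlying sets. If the legs of a cone are jointly injective
on elements, a set-theoretic lift into its apex is automatically linear and compatible with all
operations, since both sides of each required identity have the same image under every leg
(`exists_lift`). So a cone of algebras that is a limit on elements is a limit in the category.

On elements, `T` is squaring: `T(f)` is `f` applied to both coordinates. A limit problem for `T` of
a cone is therefore two independent copies of the original problem. Being an elementwise limit thus
passes from a cone to its image under `T`, and by induction to all its images under `Tᵐ`. This
reduces every limit claim to one about tuples at `m = 0`: `A ⋉ Aⁿ` is a fibre power because a point
of it is a base point with `n` vectors, and the lift is universal because `(a, b₁, b₂) ↦ (a, b₂, 0,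
b₁)` is a bijection onto the tuples whose third coordinate vanishes
(`isElementwisePullback_lift_add_zero`).

The remaining axioms are identities between maps that permute coordinates, insert zeros, or add and
negate fibre coordinates. Those without a pairing hold definitionally; the others follow from the
abelian group laws once the pairing is read in coordinates (`isPair_apply`, `isTPair_apply`). -/

/-- A morphism into `X` may be constructed elementwise if `X` carries a jointly injective family of
morphisms. -/
theorem exists_lift {K : Type*} {X Z : OperadAlgebra.{u, v, w} P}
    {Y : K → OperadAlgebra.{u, v, w} P} (f : ∀ k, X ⟶ Y k) (g : ∀ k, Z ⟶ Y k)
    (hf : ∀ x x' : X.carrier, (∀ k, (f k).toLinearMap x = (f k).toLinearMap x') → x = x')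
    (h : ∀ z : Z.carrier, ∃ x : X.carrier, ∀ k, (f k).toLinearMap x = (g k).toLinearMap z) :
    ∃ e : Z ⟶ X, ∀ k, e ≫ f k = g k := by
  choose e he using h
  -- The pointwise choice is unconstrained, but joint injectivity forces it to be additive,
  -- homogeneous and compatible with each operation, because every `g k` is.
  exact ⟨Hom.mk (A := Z) (B := X)
    { toFun := e
      map_add' := fun x y => hf _ _ fun k => by simp only [he, map_add]
      map_smul' := fun r x => hf _ _ fun k => by simp only [he, map_smul, RingHom.id_apply] }
    fun μ x => hf _ _ fun k => by
      simp only [LinearMap.coe_mk, AddHom.coe_mk, he, (f k).map_op, (g k).map_op],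
    fun k => hom_ext fun z => he z k⟩

/-! ### Limits on elements and the categorical limits they give -/

/-- The fan `f` is a product on the level of elements. -/
def IsElementwiseProduct {K : Type*} {X : OperadAlgebra.{u, v, w} P}
    {Y : K → OperadAlgebra.{u, v, w} P} (f : ∀ k, X ⟶ Y k) : Prop :=
  ∀ y : ∀ k, (Y k).carrier, ∃! x : X.carrier, ∀ k, (f k).toLinearMap x = y k

/-- On the level of elements, `X` is the fibre power of `p` with projections `q k`. -/
def IsElementwiseFibrePower {K : Type*} {X Y B : OperadAlgebra.{u, v, w} P}
    (b : X ⟶ B) (q : K → (X ⟶ Y)) (p : Y ⟶ B) : Prop :=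
  ∀ (a : B.carrier) (y : K → Y.carrier), (∀ k, p.toLinearMap (y k) = a) →
    ∃! x : X.carrier, b.toLinearMap x = a ∧ ∀ k, (q k).toLinearMap x = y k

/-- The commutative square `f, g, h, k` is a pullback on the level of elements. -/
def IsElementwisePullback {X Y Z W : OperadAlgebra.{u, v, w} P}
    (f : X ⟶ Y) (g : X ⟶ Z) (h : Y ⟶ W) (k : Z ⟶ W) : Prop :=
  ∀ (y : Y.carrier) (z : Z.carrier), h.toLinearMap y = k.toLinearMap z →
    ∃! x : X.carrier, f.toLinearMap x = y ∧ g.toLinearMap x = z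

theorem comp_congr_apply {X Y Y' Z : OperadAlgebra.{u, v, w} P} {f : X ⟶ Y} {g : Y ⟶ Z}
    {f' : X ⟶ Y'} {g' : Y' ⟶ Z} (h : f ≫ g = f' ≫ g') (x : X.carrier) :
    g.toLinearMap (f.toLinearMap x) = g'.toLinearMap (f'.toLinearMap x) :=
  congrArg (fun e : X ⟶ Z => e.toLinearMap x) h

theorem comp_eq_apply {X Y Z : OperadAlgebra.{u, v, w} P} {f : X ⟶ Y} {g : Y ⟶ Z}
    {e : X ⟶ Z} (h : f ≫ g = e) (x : X.carrier) :
    g.toLinearMap (f.toLinearMap x) = e.toLinearMap x :=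
  congrArg (fun e : X ⟶ Z => e.toLinearMap x) h

theorem IsElementwiseProduct.nonempty_isLimit {K : Type*} {X : OperadAlgebra.{u, v, w} P}
    {Y : K → OperadAlgebra.{u, v, w} P} {f : ∀ k, X ⟶ Y k} (hf : IsElementwiseProduct f) :
    Nonempty (IsLimit (Fan.mk X f)) := by
  have inj : ∀ x x' : X.carrier,
      (∀ k, (f k).toLinearMap x = (f k).toLinearMap x') → x = x' :=
    fun x x' h => (hf _).unique h fun _ => rfl
  have ex : ∀ s : Fan Y, ∃ e : s.pt ⟶ X, ∀ k, e ≫ f k = s.proj k := fun s =>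
    exists_lift f (fun k => s.proj k) inj fun z => (hf fun k => (s.proj k).toLinearMap z).exists
  choose e he using ex
  exact ⟨Fan.IsLimit.mk _ e he fun s m hm => hom_ext fun z => inj _ _ fun k =>
    comp_congr_apply ((hm k).trans (he s k).symm) z⟩

/-- The base leg is kept as part of the family: for empty `K` it is the only leg, and the hypothesis
then says that `b` is bijective. -/
theorem IsElementwiseFibrePower.nonempty_isLimit {K : Type*} {X Y B : OperadAlgebra.{u, v, w} P}
    {b : X ⟶ B} {q : K → (X ⟶ Y)} {p : Y ⟶ B} (h : IsElementwiseFibrePower b q p)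
    (w : ∀ k, q k ≫ p = b) :
    Nonempty (IsLimit (WidePullbackCone.mk (f := fun _ : K => p) b q w)) := by
  have inj : ∀ x x' : X.carrier, b.toLinearMap x = b.toLinearMap x' →
      (∀ k, (q k).toLinearMap x = (q k).toLinearMap x') → x = x' :=
    fun x x' h₁ h₂ => (h _ _ fun k => comp_eq_apply (w k) x').unique ⟨h₁, h₂⟩ ⟨rfl, fun _ => rfl⟩
  have ex : ∀ t : WidePullbackCone fun _ : K => p,
      ∃ e : t.pt ⟶ X, e ≫ b = t.base ∧ ∀ k, e ≫ q k = t.π k := fun t => by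
    -- `Option K` puts all legs into one family: `none` indexes the base leg, `some k` the `k`-th
    -- projection.
    obtain ⟨e, he⟩ := exists_lift (Z := t.pt) (X := X) (K := Option K)
      (Y := fun o => o.elim B fun _ => Y)
      (fun o => match o with | none => b | some k => q k)
      (fun o => match o with | none => t.base | some k => t.π k)
      (fun x x' hx => inj x x' (hx none) fun k => hx (some k)) (fun z => by
        obtain ⟨x, hx₁, hx₂⟩ := (h (t.base.toLinearMap z) (fun k => (t.π k).toLinearMap z)
          fun k => comp_eq_apply (t.condition k) z).exists
        refine ⟨x, fun o => ?_⟩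
        cases o
        exacts [hx₁, hx₂ _])
    exact ⟨e, he none, fun k => he (some k)⟩
  choose e he₁ he₂ using ex
  exact ⟨WidePullbackCone.IsLimit.mk _ e he₁ he₂ fun t m hm₁ hm₂ => hom_ext fun z =>
    inj _ _ (comp_congr_apply (hm₁.trans (he₁ t).symm) z)
      fun k => comp_congr_apply ((hm₂ k).trans (he₂ t k).symm) z⟩

theorem IsElementwisePullback.isPullback {X Y Z W : OperadAlgebra.{u, v, w} P}
    {f : X ⟶ Y} {g : X ⟶ Z} {h : Y ⟶ W} {k : Z ⟶ W} (H : IsElementwisePullback f g h k)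
    (w : f ≫ h = g ≫ k) : IsPullback f g h k := by
  have inj : ∀ x x' : X.carrier, f.toLinearMap x = f.toLinearMap x' →
      g.toLinearMap x = g.toLinearMap x' → x = x' :=
    fun x x' h₁ h₂ => (H _ _ (comp_congr_apply w x')).unique ⟨h₁, h₂⟩ ⟨rfl, rfl⟩
  have ex : ∀ t : PullbackCone h k, ∃ e : t.pt ⟶ X, e ≫ f = t.fst ∧ e ≫ g = t.snd := fun t => by
    obtain ⟨e, he⟩ := exists_lift (Z := t.pt) (X := X) (K := Bool)
      (Y := fun o => match o with | true => Y | false => Z)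
      (fun o => match o with | true => f | false => g)
      (fun o => match o with | true => t.fst | false => t.snd)
      (fun x x' hx => inj x x' (hx true) (hx false)) (fun z => by
        obtain ⟨x, hx₁, hx₂⟩ := (H _ _ (comp_congr_apply t.condition z)).exists
        refine ⟨x, fun o => ?_⟩
        cases o
        -- The case `false`, which carries the leg `g`, comes first.
        exacts [hx₂, hx₁])
    exact ⟨e, he true, he false⟩
  choose e he₁ he₂ using ex
  exact ⟨⟨w⟩, ⟨PullbackCone.IsLimit.mk w e he₁ he₂ fun t m hm₁ hm₂ => hom_ext fun z =>
    inj _ _ (comp_congr_apply (hm₁.trans (he₁ t).symm) z)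
      (comp_congr_apply (hm₂.trans (he₂ t).symm) z)⟩⟩

/-! ### The tangent bundle functor preserves elementwise limits -/

/-- Allows two elements found separately, one for each coordinate, to be replaced by the coordinates
of a single point of `A ⋉ A`. -/
theorem exists_sdFst_sdSnd {A : OperadAlgebra.{u, v, w} P} (a b : A.carrier) :
    ∃ x : A.semidirect.carrier, A.sdFst x = a ∧ A.sdSnd x = b :=
  ⟨(a, b), rfl, rfl⟩

/-- Since `T(f)` is `f` on each of the two coordinates, existence and uniqueness are solved
separately for first and second coordinates. The two analogues below work in the same way. -/
theorem IsElementwiseProduct.tangentFunctor_map {K : Type*} {X : OperadAlgebra.{u, v, w} P}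
    {Y : K → OperadAlgebra.{u, v, w} P} {f : ∀ k, X ⟶ Y k} (hf : IsElementwiseProduct f) :
    IsElementwiseProduct fun k => (tangentFunctor P).map (f k) := by
  intro y
  obtain ⟨a, ha, ha'⟩ := hf fun k => (Y k).sdFst (y k)
  obtain ⟨b, hb, hb'⟩ := hf fun k => (Y k).sdSnd (y k)
  obtain ⟨x, rfl, rfl⟩ := exists_sdFst_sdSnd a b
  refine ⟨x, fun k => sd_ext (ha k) (hb k), fun x' hx' => sd_ext (ha' _ fun k => ?_)
    (hb' _ fun k => ?_)⟩
  exacts [congrArg (Y k).sdFst (hx' k), congrArg (Y k).sdSnd (hx' k)]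

theorem IsElementwiseFibrePower.tangentFunctor_map {K : Type*}
    {X Y B : OperadAlgebra.{u, v, w} P} {b : X ⟶ B} {q : K → (X ⟶ Y)} {p : Y ⟶ B}
    (h : IsElementwiseFibrePower b q p) :
    IsElementwiseFibrePower ((tangentFunctor P).map b) (fun k => (tangentFunctor P).map (q k))
      ((tangentFunctor P).map p) := by
  intro a y hy
  obtain ⟨x₁, hx₁, hx₁'⟩ := h (B.sdFst a) (fun k => Y.sdFst (y k))
    fun k => congrArg B.sdFst (hy k)
  obtain ⟨x₂, hx₂, hx₂'⟩ := h (B.sdSnd a) (fun k => Y.sdSnd (y k))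
    fun k => congrArg B.sdSnd (hy k)
  obtain ⟨x, rfl, rfl⟩ := exists_sdFst_sdSnd x₁ x₂
  refine ⟨x, ⟨sd_ext hx₁.1 hx₂.1, fun k => sd_ext (hx₁.2 k) (hx₂.2 k)⟩, fun x' hx' => sd_ext
    (hx₁' _ ⟨congrArg B.sdFst hx'.1, fun k => congrArg Y.sdFst (hx'.2 k)⟩)
    (hx₂' _ ⟨congrArg B.sdSnd hx'.1, fun k => congrArg Y.sdSnd (hx'.2 k)⟩)⟩

theorem IsElementwisePullback.tangentFunctor_map {X Y Z W : OperadAlgebra.{u, v, w} P}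
    {f : X ⟶ Y} {g : X ⟶ Z} {h : Y ⟶ W} {k : Z ⟶ W} (H : IsElementwisePullback f g h k) :
    IsElementwisePullback ((tangentFunctor P).map f) ((tangentFunctor P).map g)
      ((tangentFunctor P).map h) ((tangentFunctor P).map k) := by
  intro y z hyz
  obtain ⟨x₁, hx₁, hx₁'⟩ := H (Y.sdFst y) (Z.sdFst z) (congrArg W.sdFst hyz)
  obtain ⟨x₂, hx₂, hx₂'⟩ := H (Y.sdSnd y) (Z.sdSnd z) (congrArg W.sdSnd hyz)
  obtain ⟨x, rfl, rfl⟩ := exists_sdFst_sdSnd x₁ x₂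
  exact ⟨x, ⟨sd_ext hx₁.1 hx₂.1, sd_ext hx₁.2 hx₂.2⟩, fun x' hx' => sd_ext
    (hx₁' _ ⟨congrArg Y.sdFst hx'.1, congrArg Z.sdFst hx'.2⟩)
    (hx₂' _ ⟨congrArg Y.sdSnd hx'.1, congrArg Z.sdSnd hx'.2⟩)⟩

/-- `iterFunctor` adds each new `T` on the outside, so the inductive step is one application of
stability under `T`. -/
theorem IsElementwiseFibrePower.iterFunctor_map {K : Type*}
    {X Y B : OperadAlgebra.{u, v, w} P} {b : X ⟶ B} {q : K → (X ⟶ Y)} {p : Y ⟶ B}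
    (h : IsElementwiseFibrePower b q p) (m : ℕ) :
    IsElementwiseFibrePower ((iterFunctor (tangentFunctor P) m).map b)
      (fun k => (iterFunctor (tangentFunctor P) m).map (q k))
      ((iterFunctor (tangentFunctor P) m).map p) := by
  induction m with
  | zero => exact h
  | succ m ih => exact ih.tangentFunctor_map

theorem IsElementwisePullback.iterFunctor_map {X Y Z W : OperadAlgebra.{u, v, w} P}
    {f : X ⟶ Y} {g : X ⟶ Z} {h : Y ⟶ W} {k : Z ⟶ W} (H : IsElementwisePullback f g h k)
    (m : ℕ) :
    IsElementwisePullback ((iterFunctor (tangentFunctor P) m).map f)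
      ((iterFunctor (tangentFunctor P) m).map g) ((iterFunctor (tangentFunctor P) m).map h)
      ((iterFunctor (tangentFunctor P) m).map k) := by
  induction m with
  | zero => exact H
  | succ m ih => exact ih.tangentFunctor_map

/-! ### Products of algebras -/

/-- The componentwise operations on a product of algebras. -/
def piOps {K : Type w} (A : K → OperadAlgebra.{u, v, w} P) (n : ℕ) : P.obj n →ₗ[R]
    MultilinearMap R (fun _ : Fin n => ∀ k, (A k).carrier) (∀ k, (A k).carrier) where
  toFun μ := MultilinearMap.pi fun k => ((A k).op μ).compLinearMap fun _ => LinearMap.proj k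
  map_add' μ μ' := by ext x k; simp [op_add]
  map_smul' r μ := by ext x k; simp [op_smul]

theorem piOps_apply {K : Type w} (A : K → OperadAlgebra.{u, v, w} P) {n : ℕ} (μ : P.obj n)
    (x : Fin n → ∀ k, (A k).carrier) (k : K) :
    piOps A n μ x k = (A k).op μ fun i => x i k := rfl

theorem piOps_act {K : Type w} (A : K → OperadAlgebra.{u, v, w} P) (n : ℕ)
    (σ : Equiv.Perm (Fin n)) (μ : P.obj n) (x : Fin n → ∀ k, (A k).carrier) :
    piOps A n (P.act σ μ) x = piOps A n μ fun i => x (σ⁻¹ i) :=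
  funext fun k => by simp only [piOps_apply, op_act]

/-- The product of a family of algebras. -/
def pi {K : Type w} (A : K → OperadAlgebra.{u, v, w} P) : OperadAlgebra.{u, v, w} P :=
  ofOps (∀ k, (A k).carrier) (piOps A) (piOps_act A)
    (fun a => funext fun k => by rw [piOps_apply, op_one])
    (fun μ ν a => funext fun k => by
      simp only [piOps_apply]
      exact (A k).op_comp μ ν fun i t => a i t k)

/-- The projections of a product of algebras. -/
def piProj {K : Type w} (A : K → OperadAlgebra.{u, v, w} P) (k : K) : pi A ⟶ A k :=
  Hom.mk (A := pi A) (B := A k) (LinearMap.proj (φ := fun k => (A k).carrier) k) fun μ x =>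
    congrFun (Operad.liftS_cls (piOps A) (piOps_act A) μ x) k

theorem isElementwiseProduct_piProj {K : Type w} (A : K → OperadAlgebra.{u, v, w} P) :
    IsElementwiseProduct (piProj A) :=
  fun y => ⟨y, fun _ => rfl, fun _ hx => funext hx⟩

instance hasProducts : HasProducts.{w} (OperadAlgebra.{u, v, w} P) :=
  hasProducts_of_limit_fans (fun A => Fan.mk (pi A) (piProj A))
    fun A => (isElementwiseProduct_piProj A).nonempty_isLimit.some

/-- Preservation may be tested on one limit fan. The explicit product is elementwise, so its image
under `T` is an elementwise product too, hence a limit. -/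
instance tangentFunctor_preservesLimit {K : Type w} (A : K → OperadAlgebra.{u, v, w} P) :
    PreservesLimit (Discrete.functor A) (tangentFunctor.{u, v, w} P) :=
  have h := isElementwiseProduct_piProj A
  preservesLimit_of_preserves_limit_cone h.nonempty_isLimit.some
    ((isLimitMapConeFanMkEquiv _ A (piProj A)).symm h.tangentFunctor_map.nonempty_isLimit.some)

instance tangentFunctor_preservesLimitsOfShape (K : Type w) :
    PreservesLimitsOfShape (Discrete K) (tangentFunctor.{u, v, w} P) :=
  preservesLimitsOfShape_of_discrete _

instance hasFiniteProducts : HasFiniteProducts (OperadAlgebra.{u, v, w} P) :=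
  hasFiniteProducts_of_hasProducts _

instance tangentFunctor_preservesFiniteProducts :
    PreservesFiniteProducts (tangentFunctor.{u, v, w} P) where
  -- Products above are indexed by types in universe `w`; `ULift` moves `Fin n` there.
  preserves _ := preservesLimitsOfShape_of_equiv (Discrete.equivalence Equiv.ulift) _

/-! ### The tangent structure -/

/-- `A ⋉ Aⁿ` is the `n`-fold fibre power of `A ⋉ A` over `A`. -/
theorem isElementwiseFibrePower_tangentPowProj (A : OperadAlgebra.{u, v, w} P) (n : ℕ) :
    IsElementwiseFibrePower ((tangentPowBase P n).app A)
      (fun j => (tangentPowProj P n j).app A) ((tangentProj P).app A) := by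
  intro a y hy
  refine ⟨((a, fun j => A.sdSnd (y j)) : A.carrier × (Fin n → A.carrier)),
    ⟨rfl, fun j => sd_ext (hy j).symm rfl⟩, ?_⟩
  rintro x ⟨hx₁, hx₂⟩
  exact pow_ext hx₁ fun j => congrArg A.sdSnd (hx₂ j)

/-! ### Pairings in coordinates and universality of the vertical lift -/

section

open RosickyTangentData

variable {X A : OperadAlgebra.{u, v, w} P}

/-- A pairing is determined by its coordinates: a base point, shared by `f` and `g`, and their two
fibre coordinates. The base point is recorded from both legs, because commutativity of the sum
compares pairings with the legs swapped. -/
theorem isPair_apply {u : X ⟶ (tangentPowFunctor P 2).obj A} {f g : X ⟶ (tangentFunctor P).obj A}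
    (h : IsPair (D := tangentData P) u f g) (x : X.carrier) :
    A.powFst 2 (u.toLinearMap x) = A.sdFst (f.toLinearMap x) ∧
      A.powFst 2 (u.toLinearMap x) = A.sdFst (g.toLinearMap x) ∧
      A.powSnd 2 0 (u.toLinearMap x) = A.sdSnd (f.toLinearMap x) ∧
      A.powSnd 2 1 (u.toLinearMap x) = A.sdSnd (g.toLinearMap x) :=
  ⟨congrArg A.sdFst (comp_eq_apply h.1 x), congrArg A.sdFst (comp_eq_apply h.2 x),
    congrArg A.sdSnd (comp_eq_apply h.1 x), congrArg A.sdSnd (comp_eq_apply h.2 x)⟩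

theorem isTPair_apply {u : X ⟶ (tangentFunctor P).obj ((tangentPowFunctor P 2).obj A)}
    {f g : X ⟶ (tangentFunctor P).obj ((tangentFunctor P).obj A)}
    (h : IsTPair (D := tangentData P) u f g) (x : X.carrier) :
    ((A.powFst 2 ((A.semidirectPow 2).sdFst (u.toLinearMap x)) =
          A.sdFst (A.semidirect.sdFst (f.toLinearMap x)) ∧
        A.powSnd 2 0 ((A.semidirectPow 2).sdFst (u.toLinearMap x)) =
          A.sdSnd (A.semidirect.sdFst (f.toLinearMap x)) ∧
        A.powSnd 2 1 ((A.semidirectPow 2).sdFst (u.toLinearMap x)) =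
          A.sdSnd (A.semidirect.sdFst (g.toLinearMap x))) ∧
      (A.powFst 2 ((A.semidirectPow 2).sdSnd (u.toLinearMap x)) =
          A.sdFst (A.semidirect.sdSnd (f.toLinearMap x)) ∧
        A.powSnd 2 0 ((A.semidirectPow 2).sdSnd (u.toLinearMap x)) =
          A.sdSnd (A.semidirect.sdSnd (f.toLinearMap x)) ∧
        A.powSnd 2 1 ((A.semidirectPow 2).sdSnd (u.toLinearMap x)) =
          A.sdSnd (A.semidirect.sdSnd (g.toLinearMap x)))) := by
  have h₁ := comp_eq_apply h.1 x
  have h₂ := comp_eq_apply h.2 x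
  exact ⟨⟨congrArg (fun y => A.sdFst (A.semidirect.sdFst y)) h₁,
    congrArg (fun y => A.sdSnd (A.semidirect.sdFst y)) h₁,
    congrArg (fun y => A.sdSnd (A.semidirect.sdFst y)) h₂⟩,
    ⟨congrArg (fun y => A.sdFst (A.semidirect.sdSnd y)) h₁,
    congrArg (fun y => A.sdSnd (A.semidirect.sdSnd y)) h₁,
    congrArg (fun y => A.sdSnd (A.semidirect.sdSnd y)) h₂⟩⟩

/-- On elements, the map `T(s) ∘ ⟨l ∘ q₁, z ∘ q₂⟩` sends `(a, b₁, b₂)` to `(a, b₂, 0, b₁)`. -/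
theorem lift_add_zero_apply
    {u : (tangentPowFunctor P 2).obj A ⟶ (tangentFunctor P).obj ((tangentPowFunctor P 2).obj A)}
    (h : IsTPair (D := tangentData P) u
      ((tangentPowProj P 2 0).app A ≫ (tangentLift P).app A)
      ((tangentPowProj P 2 1).app A ≫ (tangentZero P).app ((tangentFunctor P).obj A)))
    (x : (A.semidirectPow 2).carrier) :
    (u ≫ (tangentFunctor P).map ((tangentSum P).app A)).toLinearMap x =
      (((A.powFst 2 x, A.powSnd 2 1 x), (0, A.powSnd 2 0 x)) :
        (A.carrier × A.carrier) × (A.carrier × A.carrier)) := by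
  obtain ⟨⟨h₁, h₂, h₃⟩, h₄, h₅, h₆⟩ := isTPair_apply h x
  refine sd_ext (sd_ext h₁ ?_) (sd_ext h₄ ?_)
  -- The summands are `l(a, b₁) = (a, 0, 0, b₁)` and `z(a, b₂) = (a, b₂, 0, 0)`, so each sum of
  -- fibre coordinates has one zero term.
  · exact (congrArg₂ (· + ·) h₂ h₃).trans (zero_add _)
  · exact (congrArg₂ (· + ·) h₅ h₆).trans (add_zero _)

/-- For `y = (a, b, c, d)`, the equation `T(p)(y) = z(a')` says `a = a'` and `c = 0`, leaving `b`
and `d` free. These are exactly the two fibre coordinates of a point of `A ⋉ A²`. -/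
theorem isElementwisePullback_lift_add_zero
    {u : (tangentPowFunctor P 2).obj A ⟶ (tangentFunctor P).obj ((tangentPowFunctor P 2).obj A)}
    (h : IsTPair (D := tangentData P) u
      ((tangentPowProj P 2 0).app A ≫ (tangentLift P).app A)
      ((tangentPowProj P 2 1).app A ≫ (tangentZero P).app ((tangentFunctor P).obj A))) :
    IsElementwisePullback (u ≫ (tangentFunctor P).map ((tangentSum P).app A))
      ((tangentPowBase P 2).app A) ((tangentFunctor P).map ((tangentProj P).app A))
      ((tangentZero P).app A) := by
  intro y z hyz
  have hy₁ : A.sdFst (A.semidirect.sdFst y) = z := congrArg A.sdFst hyz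
  have hy₂ : A.sdFst (A.semidirect.sdSnd y) = 0 := congrArg A.sdSnd hyz
  -- The order is reversed: the first fibre coordinate passes through the lift into the last slot,
  -- the second through the zero map into the second slot.
  refine ⟨((z, ![A.sdSnd (A.semidirect.sdSnd y), A.sdSnd (A.semidirect.sdFst y)]) :
    A.carrier × (Fin 2 → A.carrier)), ⟨?_, rfl⟩, ?_⟩
  · refine (lift_add_zero_apply h _).trans ?_
    exact Prod.ext (Prod.ext hy₁.symm rfl) (Prod.ext hy₂.symm rfl)
  · rintro x ⟨hx, hx'⟩
    replace hx := (lift_add_zero_apply h x).symm.trans hx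
    refine pow_ext hx' fun j => ?_
    fin_cases j
    · exact congrArg (fun y => A.sdSnd (A.semidirect.sdSnd y)) hx
    · exact congrArg (fun y => A.sdSnd (A.semidirect.sdFst y)) hx

end

/-! ### Verification of the axioms -/

variable (P)

open RosickyTangentData in
theorem isRosickyTangent_tangentData : (tangentData.{u, v, w} P).IsRosickyTangent where
  isLimit_pow m n A :=
    ((isElementwiseFibrePower_tangentPowProj A n).iterFunctor_map m).nonempty_isLimit _
  s_p _ := rfl
  z_p _ := rfl
  s_assoc {X A} f g h u u' v v' hu hu' hv hv' := by
    refine hom_ext fun x => ?_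
    obtain ⟨a₁, -, a₃, a₄⟩ := isPair_apply hu x
    obtain ⟨b₁, -, b₃, b₄⟩ := isPair_apply hu' x
    obtain ⟨-, -, c₃, c₄⟩ := isPair_apply hv x
    obtain ⟨d₁, -, d₃, d₄⟩ := isPair_apply hv' x
    refine sd_ext (b₁.trans (a₁.trans d₁.symm)) ?_
    -- With fibre coordinates `b₁, b₂, b₃` of `f, g, h`, the pairing `u'` has `(b₁ + b₂, b₃)` and
    -- `v'` has `(b₁, b₂ + b₃)`.
    refine (congrArg₂ (· + ·) (b₃.trans (congrArg₂ (· + ·) a₃ a₄)) b₄).trans ?_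
    refine .trans ?_ (congrArg₂ (· + ·) d₃ (d₄.trans (congrArg₂ (· + ·) c₃ c₄))).symm
    exact add_assoc _ _ _
  s_comm {X A} f g u v hu hv := by
    refine hom_ext fun x => ?_
    obtain ⟨a₁, -, a₃, a₄⟩ := isPair_apply hu x
    obtain ⟨-, b₂, b₃, b₄⟩ := isPair_apply hv x
    refine sd_ext (a₁.trans b₂.symm) ?_
    exact (congrArg₂ (· + ·) a₃ a₄).trans
      ((add_comm _ _).trans (congrArg₂ (· + ·) b₃ b₄).symm)
  s_zero {X A} f u hu := by
    refine hom_ext fun x => ?_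
    obtain ⟨a₁, -, a₃, a₄⟩ := isPair_apply hu x
    exact sd_ext a₁ ((congrArg₂ (· + ·) a₃ a₄).trans (add_zero _))
  l_Tp _ := rfl
  z_l _ := rfl
  s_l A u hu := by
    refine hom_ext fun x => ?_
    obtain ⟨⟨h₁, h₂, h₃⟩, h₄, h₅, h₆⟩ := isTPair_apply hu x
    -- Both sides send `(a, b₁, b₂)` to `(a, 0, 0, b₁ + b₂)`; on the right the first zero arises as
    -- `0 + 0`.
    exact sd_ext (sd_ext h₁.symm ((congrArg₂ (· + ·) h₂ h₃).trans (add_zero _)).symm)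
      (sd_ext h₄.symm (congrArg₂ (· + ·) h₅ h₆).symm)
  c_p _ := rfl
  Tz_c _ := rfl
  Ts_c A u hu := by
    refine hom_ext fun x => ?_
    obtain ⟨h₁, -, h₃, h₄⟩ := isPair_apply hu x
    -- After the flip the sum is taken in `A ⋉ A`. Addition there is componentwise, so it agrees
    -- with adding before the flip.
    refine sd_ext (h₁.trans ?_).symm ((congrArg₂ (· + ·) h₃ h₄).trans ?_).symm
    · exact sd_ext rfl rfl
    · exact sd_ext rfl rfl
  c_c _ := rfl
  l_c _ := rfl
  l_l _ := rfl
  c_c_c _ := rfl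
  l_c_c _ := rfl
  universal A u hu m := by
    refine ((isElementwisePullback_lift_add_zero hu).iterFunctor_map m).isPullback ?_
    -- Functoriality reduces commutativity of the square to `m = 0`, where both composites send `(a,
    -- b₁, b₂)` to `(a, 0)`.
    rw [← Functor.map_comp, ← Functor.map_comp]
    congr 1
    refine hom_ext fun x => ?_
    have h := lift_add_zero_apply hu x
    exact sd_ext (congrArg (fun y => A.sdFst (A.semidirect.sdFst y)) h)
      (congrArg (fun y => A.sdFst (A.semidirect.sdSnd y)) h)
  neg_p _ := rfl
  s_neg A u hu := by
    refine hom_ext fun x => ?_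
    obtain ⟨h₁, -, h₃, h₄⟩ := isPair_apply hu x
    exact sd_ext h₁ ((congrArg₂ (· + ·) h₃ h₄).trans (add_neg_cancel _))

end OperadAlgebra

theorem mainTheorem1 {R : Type u} [CommRing R] (P : Operad.{u, v} R) :
    (OperadAlgebra.tangentData.{u, v, w} P).IsCartesianRosickyTangent where
  toIsRosickyTangent := OperadAlgebra.isRosickyTangent_tangentData P
  hasFiniteProducts := OperadAlgebra.hasFiniteProducts
  -- The functor is named explicitly so that its preservation of finite products is found. The
  -- terminal case is the empty product, `terminalComparison` being by definition the map to the
  -- terminal object.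
  isIso_piComparison _ A :=
    inferInstanceAs (IsIso (piComparison (OperadAlgebra.tangentFunctor.{u, v, w} P) A))
  isIso_terminal :=
    inferInstanceAs (IsIso (terminalComparison (OperadAlgebra.tangentFunctor.{u, v, w} P)))
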